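/- Let $n$ be a natural number and let $G$ be any $2$-subgroup of $\mathrm{GL}(n,2)$, the group of invertible $n\times n$ matrices over the field $\mathbb{F}_2$ with two elements. Then $G$ can be generated by at most $\frac{n^2}{4}$ elements. -/

import Mathlib

/-! A 2-group acts unitriangularly in a suitable basis (`IsPGroup.exists_unitriangular_basis`). Give
position (i, j) weight 2^j - 2^i: distinct positions have distinct weights, so every g ≠ 1 has a
single leading entry, necessarily 1 over F_2. Elements realising all leading positions of G generate
G, by successive cancellation. Let E be the positions led by elements of G but by none of the
commutator subgroup G'. Commuting leaders at (i, j) and (j, k) yields one at (i, k), so E is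
triangle-free and Mantel's bound gives |E| ≤ n²/4. One element per position of E generates G
together with G', and G' is superfluous because G is nilpotent. -/

/-- A set of increasing pairs without transitive triangles has at most `n ^ 2 / 4` elements. -/
theorem four_mul_card_le_sq_of_triangleFree {n : ℕ} (E : Finset (Fin n × Fin n))
    (hlt : ∀ i j, (i, j) ∈ E → i < j)
    (htri : ∀ i j k, (i, j) ∈ E → (j, k) ∈ E → (i, k) ∉ E) : 4 * E.card ≤ n ^ 2 := by
  classical
  let Γ : SimpleGraph (Fin n) :=
    { Adj := fun i j => (i, j) ∈ E ∨ (j, i) ∈ E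
      symm := ⟨fun i j h => h.symm⟩
      loopless := ⟨fun i h => by rcases h with h | h <;> exact lt_irrefl _ (hlt _ _ h)⟩ }
  have hfree : Γ.CliqueFree (2 + 1) := by
    intro s hs
    obtain ⟨x, y, z, hxy, hxz, hyz, -⟩ := SimpleGraph.is3Clique_iff.1 hs
    have hcyc : ∀ i j k, (i, j) ∈ E → (j, k) ∈ E → (k, i) ∈ E → False := fun i j k h₁ h₂ h₃ =>
      lt_irrefl _ (((hlt _ _ h₁).trans (hlt _ _ h₂)).trans (hlt _ _ h₃))
    rcases hxy with hxy | hxy <;> rcases hxz with hxz | hxz <;> rcases hyz with hyz | hyz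
    · exact htri _ _ _ hxy hyz hxz
    · exact htri _ _ _ hxz hyz hxy
    · exact hcyc _ _ _ hxy hyz hxz
    · exact htri _ _ _ hxz hxy hyz
    · exact htri _ _ _ hxy hxz hyz
    · exact hcyc _ _ _ hxy hxz hyz
    · exact htri _ _ _ hyz hxz hxy
    · exact htri _ _ _ hyz hxy hxz
  have hle : E.card ≤ Γ.edgeFinset.card := by
    refine Finset.card_le_card_of_injOn (fun p => s(p.1, p.2)) ?_ ?_
    · rintro ⟨i, j⟩ h
      simpa [Γ] using Or.inl h
    · rintro ⟨i, j⟩ h ⟨k, l⟩ h' heq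
      rcases Sym2.eq_iff.1 heq with ⟨h₁, h₂⟩ | ⟨h₁, h₂⟩
      · exact Prod.ext h₁ h₂
      · have h₃ := hlt _ _ h
        have h₄ := hlt _ _ h'
        simp only at h₁ h₂
        subst h₁ h₂
        exact absurd h₃ h₄.asymm
  have hturan := hfree.card_edgeFinset_le
  -- This is the remainder term of Turán's bound, which vanishes for two parts.
  have hchoose : (n % 2).choose 2 = 0 := Nat.choose_eq_zero_of_lt (Nat.mod_lt _ two_pos)
  simp only [Fintype.card_fin, hchoose] at hturan
  omega

/-- In a finite nilpotent group, a subgroup that generates the group together with the commutator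
subgroup is the whole group. -/
theorem eq_top_of_sup_commutator_eq_top {G : Type*} [Group G] [Finite G]
    [Group.IsNilpotent G] (H : Subgroup G) (h : H ⊔ commutator G = ⊤) : H = ⊤ := by
  by_contra hH
  obtain ⟨M, hM, hHM⟩ := (eq_top_or_exists_le_coatom H).resolve_left hH
  have hMn : M.Normal :=
    Subgroup.NormalizerCondition.normal_of_coatom M Group.normalizerCondition_of_isNilpotent hM
  have hMtop : M ⊔ commutator G = ⊤ := top_le_iff.1 (h ▸ sup_le_sup_right hHM _)
  have : Nontrivial (G ⧸ M) := QuotientGroup.nontrivial_iff.2 hM.1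
  -- The contradiction: `G ⧸ M` is nontrivial and solvable, yet the commutator subgroup would map
  -- onto it.
  have hlt := Group.IsSolvable.commutator_lt_top_of_nontrivial (G ⧸ M)
  refine hlt.ne (top_le_iff.1 ?_)
  calc (⊤ : Subgroup (G ⧸ M)) = (M ⊔ commutator G).map (QuotientGroup.mk' M) := by
        rw [hMtop, ← MonoidHom.range_eq_map, QuotientGroup.range_mk']
    _ = (commutator G).map (QuotientGroup.mk' M) := by
        rw [Subgroup.map_sup, QuotientGroup.map_mk'_self, bot_sup_eq]
    _ ≤ commutator (G ⧸ M) := by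
        rw [commutator_def, commutator_def, Subgroup.map_commutator]
        exact Subgroup.commutator_mono le_top le_top

/-! ### Unitriangular bases for p-groups -/

/-- A finite `p`-group acting linearly on a finite vector space over `ZMod p` and preserving a
proper subspace `W` fixes a nonzero vector modulo `W`. -/
theorem IsPGroup.exists_notMem_sub_mem {p : ℕ} [Fact p.Prime] {G V : Type*} [Group G]
    (hG : IsPGroup p G) [AddCommGroup V] [Module (ZMod p) V] [Finite V]
    (ρ : G →* Module.End (ZMod p) V) (W : Submodule (ZMod p) V) (hW : W ≠ ⊤)
    (hinv : ∀ g, W ≤ W.comap (ρ g)) : ∃ v, v ∉ W ∧ ∀ g, ρ g v - v ∈ W := by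
  let _ : MulAction G (V ⧸ W) :=
    { smul := fun g x => W.mapQ W (ρ g) (hinv g) x
      one_smul := fun x => by
        induction x using Submodule.Quotient.induction_on with
        | _ x => change Submodule.Quotient.mk (ρ 1 x) = _; simp
      mul_smul := fun g h x => by
        induction x using Submodule.Quotient.induction_on with
        | _ x =>
          change Submodule.Quotient.mk (ρ (g * h) x) = Submodule.Quotient.mk (ρ g (ρ h x))
          simp }
  have : Finite (V ⧸ W) := Finite.of_surjective _ (Submodule.Quotient.mk_surjective W)
  have : Nontrivial (V ⧸ W) := Submodule.Quotient.nontrivial_iff.2 hW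
  have hdvd : p ∣ Nat.card (V ⧸ W) := by
    rw [Module.natCard_eq_pow_finrank (K := ZMod p), Nat.card_zmod]
    exact dvd_pow_self p (Module.finrank_pos).ne'
  have h0 : (0 : V ⧸ W) ∈ MulAction.fixedPoints G (V ⧸ W) := fun g => map_zero (W.mapQ W (ρ g) _)
  obtain ⟨b, hb, hb0⟩ := hG.exists_fixed_point_of_prime_dvd_card_of_fixed_point _ hdvd h0
  obtain ⟨v, rfl⟩ := Submodule.Quotient.mk_surjective W b
  refine ⟨v, fun hv => hb0 ((Submodule.Quotient.mk_eq_zero W).2 hv).symm, fun g => ?_⟩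
  exact (Submodule.Quotient.eq W).1 (hb g)

/-- A `p`-group acting linearly on a finite vector space over `ZMod p` has a basis on which it
acts unitriangularly. -/
theorem IsPGroup.exists_unitriangular_basis {p : ℕ} [Fact p.Prime] {G V : Type*} [Group G]
    (hG : IsPGroup p G) [AddCommGroup V] [Module (ZMod p) V] [Finite V]
    (ρ : G →* Module.End (ZMod p) V) {n : ℕ} (hn : Module.finrank (ZMod p) V = n) :
    ∃ b : Module.Basis (Fin n) (ZMod p) V,
      ∀ g j, ρ g (b j) - b j ∈ Submodule.span (ZMod p) (b '' Set.Iio j) := by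
  have key : ∀ k ≤ n, ∃ v : Fin k → V, LinearIndependent (ZMod p) v ∧
      ∀ g j, ρ g (v j) - v j ∈ Submodule.span (ZMod p) (v '' Set.Iio j) := by
    intro k
    induction k with
    | zero => exact fun _ => ⟨Fin.elim0, linearIndependent_empty_type, fun _ j => j.elim0⟩
    | succ k ih =>
      intro hk
      obtain ⟨v, hv, hvG⟩ := ih (by omega)
      set W := Submodule.span (ZMod p) (Set.range v) with hWdef
      have hW : W ≠ ⊤ := by
        intro h
        have h₁ := finrank_span_eq_card hv
        rw [← hWdef, h, finrank_top, hn, Fintype.card_fin] at h₁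
        omega
      have hinv : ∀ g, W ≤ W.comap (ρ g) := by
        intro g
        refine Submodule.span_le.2 ?_
        rintro _ ⟨j, rfl⟩
        have h₁ : ρ g (v j) - v j ∈ W := Submodule.span_mono (Set.image_subset_range _ _) (hvG g j)
        simpa using W.add_mem h₁ (Submodule.subset_span (Set.mem_range_self j))
      obtain ⟨w, hw, hwG⟩ := hG.exists_notMem_sub_mem ρ W hW hinv
      refine ⟨Fin.snoc v w, linearIndependent_finSnoc.2 ⟨hv, hw⟩, fun g j => ?_⟩
      induction j using Fin.lastCases with
      | last =>
        simp only [Fin.snoc_last]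
        refine Submodule.span_mono ?_ (hwG g)
        rintro _ ⟨i, rfl⟩
        exact ⟨i.castSucc, Fin.castSucc_lt_last i, by simp⟩
      | cast j =>
        simp only [Fin.snoc_castSucc]
        refine Submodule.span_mono ?_ (hvG g j)
        rintro _ ⟨i, hi, rfl⟩
        exact ⟨i.castSucc, Fin.castSucc_lt_castSucc_iff.2 hi, by simp⟩
  obtain ⟨v, hv, hvG⟩ := key n le_rfl
  refine ⟨basisOfLinearIndependentOfCardEqFinrank' v hv (by simp [hn]), ?_⟩
  simpa using hvG

/-! ### Weights and leading entries -/

/-- Matrices whose nonzero entries `(k, l)` all have weight `a l - a k` at least `m`. -/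
def Matrix.weightFiltration {n : ℕ} {R : Type*} [Ring R] (a : Fin n → ℤ) (m : ℤ) :
    AddSubgroup (Matrix (Fin n) (Fin n) R) where
  carrier := {A | ∀ k l, A k l ≠ 0 → m ≤ a l - a k}
  zero_mem' := fun k l h => absurd rfl h
  add_mem' := by
    intro A B hA hB k l h
    by_cases hAkl : A k l = 0
    · exact hB k l fun hBkl => h (by simp [hAkl, hBkl])
    · exact hA k l hAkl
  neg_mem' := fun hA k l h => hA k l fun h0 => h (by simp [h0])

namespace Matrix.weightFiltration

variable {n : ℕ} {R : Type*} [Ring R] {a : Fin n → ℤ} {m m' : ℤ} {A B : Matrix (Fin n) (Fin n) R}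

theorem mono (h : m' ≤ m) (hA : A ∈ weightFiltration a m) : A ∈ weightFiltration a m' :=
  fun k l hkl => h.trans (hA k l hkl)

theorem mul_mem (hA : A ∈ weightFiltration a m) (hB : B ∈ weightFiltration a m') :
    A * B ∈ weightFiltration a (m + m') := by
  intro k l h
  rw [Matrix.mul_apply] at h
  obtain ⟨x, -, hx⟩ := Finset.exists_ne_zero_of_sum_ne_zero h
  have h₁ := hA k x (left_ne_zero_of_mul hx)
  have h₂ := hB x l (right_ne_zero_of_mul hx)
  linarith

theorem mul_mem_of_le {r : ℤ} (hA : A ∈ weightFiltration a m) (hB : B ∈ weightFiltration a m')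
    (hr : r ≤ m + m') : A * B ∈ weightFiltration a r :=
  mono hr (mul_mem hA hB)

theorem one_mem : (1 : Matrix (Fin n) (Fin n) R) ∈ weightFiltration a 0 := by
  intro k l h
  have : k = l := by
    by_contra hkl
    exact h (Matrix.one_apply_ne hkl)
  simp [this]

theorem single_mem (i j : Fin n) (c : R) :
    Matrix.single i j c ∈ weightFiltration a (a j - a i) := by
  intro k l h
  have : i = k ∧ j = l := by
    by_contra hkl
    exact h (Matrix.single_apply_of_ne _ _ _ _ _ hkl)
  rw [this.1, this.2]

end Matrix.weightFiltration

open Matrix in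
/-- The unipotent matrix `A` has leading entry `(i, j)` with respect to the weights `a`. -/
def Matrix.HasUnipotentLeadingEntry {n : ℕ} (a : Fin n → ℤ) (A : Matrix (Fin n) (Fin n) (ZMod 2))
    (i j : Fin n) : Prop :=
  i < j ∧ A - 1 - Matrix.single i j 1 ∈ weightFiltration a (a j - a i + 1)

namespace Matrix.HasUnipotentLeadingEntry

open Matrix

variable {n : ℕ} {a : Fin n → ℤ} {A B C D : Matrix (Fin n) (Fin n) (ZMod 2)} {i j k : Fin n}

theorem sub_one_mem (hA : A.HasUnipotentLeadingEntry a i j) : A - 1 ∈ weightFiltration a (a j - a i) := by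
  rw [← sub_add_cancel (A - 1) (single i j 1)]
  exact add_mem (weightFiltration.mono (by linarith) hA.2) (weightFiltration.single_mem i j 1)

theorem le_weight {m : ℤ} (hA : A.HasUnipotentLeadingEntry a i j) (hm : A - 1 ∈ weightFiltration a m) :
    m ≤ a j - a i := by
  refine hm i j fun h0 => ?_
  have h := hA.2 i j (by rw [sub_apply, h0, single_apply_same]; decide)
  linarith

/-- The leading terms cancel in characteristic 2, and the cross term has twice the positive weight
`a j - a i`. -/
theorem mul_sub_one_mem (ha : StrictMono a) (hA : A.HasUnipotentLeadingEntry a i j)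
    (hB : B.HasUnipotentLeadingEntry a i j) : A * B - 1 ∈ weightFiltration a (a j - a i + 1) := by
  have h₂ : single i j (1 : ZMod 2) + single i j 1 = 0 := by
    rw [← single_add, show (1 : ZMod 2) + 1 = 0 by decide, single_zero]
  have h : A * B - 1 = (A - 1 - single i j 1) + (B - 1 - single i j 1) + (A - 1) * (B - 1) := by
    rw [show (A - 1 - single i j 1) + (B - 1 - single i j 1) + (A - 1) * (B - 1) =
      A * B - 1 - (single i j 1 + single i j 1) by noncomm_ring, h₂, sub_zero]
  have hw := ha hA.1
  rw [h]
  exact add_mem (add_mem hA.2 hB.2)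
    (weightFiltration.mul_mem_of_le hA.sub_one_mem hB.sub_one_mem (by linarith))

/-- If `A`, `B` have leading entries `(i, j)`, `(j, k)` and `C` is their commutator, then `C` has
leading entry `(i, k)`. -/
theorem commutator (ha : StrictMono a) (hA : A.HasUnipotentLeadingEntry a i j)
    (hB : B.HasUnipotentLeadingEntry a j k) (hD : D - 1 ∈ weightFiltration a 1) (hBAD : B * A * D = 1)
    (hC : C = A * B * D) : C.HasUnipotentLeadingEntry a i k := by
  have hij := ha hA.1
  have hjk := ha hB.1
  have hik := hA.1.trans hB.1
  refine ⟨hik, ?_⟩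
  have hAB : (A - 1) * (B - 1) - single i k 1 ∈ weightFiltration a (a k - a i + 1) := by
    have h : (A - 1) * (B - 1) - single i k 1 =
        (A - 1 - single i j 1) * (B - 1) + single i j 1 * (B - 1 - single j k 1) := by
      rw [show (single i k 1 : Matrix (Fin n) (Fin n) (ZMod 2)) = single i j 1 * single j k 1 by
        simp]
      noncomm_ring
    rw [h]
    exact add_mem (weightFiltration.mul_mem_of_le hA.2 hB.sub_one_mem (by linarith))
      (weightFiltration.mul_mem_of_le (weightFiltration.single_mem i j 1) hB.2 (by linarith))
  -- In this order the leading terms multiply to zero because i ≠ k.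
  have hBA : (B - 1) * (A - 1) ∈ weightFiltration a (a k - a i + 1) := by
    have h : (B - 1) * (A - 1) =
        (B - 1 - single j k 1) * (A - 1) + single j k 1 * (A - 1 - single i j 1) := by
      have h0 : (single j k 1 : Matrix (Fin n) (Fin n) (ZMod 2)) * single i j 1 = 0 :=
        single_mul_single_of_ne _ _ _ _ hik.ne' _
      rw [mul_sub (single j k 1), h0]
      noncomm_ring
    rw [h]
    exact add_mem (weightFiltration.mul_mem_of_le hB.2 hA.sub_one_mem (by linarith))
      (weightFiltration.mul_mem_of_le (weightFiltration.single_mem j k 1) hA.2 (by linarith))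
  have hcomm : (A - 1) * (B - 1) - (B - 1) * (A - 1) ∈ weightFiltration a (a k - a i) :=
    sub_mem
      (weightFiltration.mul_mem_of_le hA.sub_one_mem hB.sub_one_mem (by linarith))
      (weightFiltration.mul_mem_of_le hB.sub_one_mem hA.sub_one_mem (by linarith))
  have h : C - 1 - single i k 1 = ((A - 1) * (B - 1) - single i k 1) - (B - 1) * (A - 1) +
      ((A - 1) * (B - 1) - (B - 1) * (A - 1)) * (D - 1) := by
    have h₁ : (A - 1) * (B - 1) - (B - 1) * (A - 1) = A * B - B * A := by noncomm_ring
    have h₂ : C - 1 = ((A - 1) * (B - 1) - (B - 1) * (A - 1)) * D := by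
      rw [h₁, sub_mul, hC, hBAD]
    rw [h₂, mul_sub _ D, mul_one]
    abel
  rw [h]
  exact add_mem (sub_mem hAB hBA) (weightFiltration.mul_mem_of_le hcomm hD (by linarith))

end Matrix.HasUnipotentLeadingEntry

/-- The weights `2 ^ i` separate the positions above the diagonal. -/
theorem two_pow_sub_two_pow_injective {i j k l : ℕ} (hij : i < j) (hkl : k < l)
    (h : (2 : ℤ) ^ j - 2 ^ i = 2 ^ l - 2 ^ k) : i = k ∧ j = l := by
  -- If j < l, then 2^l - 2^k ≥ 2^(l-1) ≥ 2^j > 2^j - 2^i.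
  have key : ∀ {i j k l : ℕ}, i < j → k < l → (2 : ℤ) ^ j - 2 ^ i = 2 ^ l - 2 ^ k → ¬ j < l := by
    intro i j k l hij hkl h hjl
    have h₁ : (2 : ℤ) ^ k ≤ 2 ^ (l - 1) := pow_le_pow_right₀ (by norm_num) (by omega)
    have h₂ : (2 : ℤ) ^ j ≤ 2 ^ (l - 1) := pow_le_pow_right₀ (by norm_num) (by omega)
    have h₃ : (2 : ℤ) ^ l = 2 * 2 ^ (l - 1) := by rw [← pow_succ']; congr 1; omega
    have h₄ : (0 : ℤ) < 2 ^ i := by positivity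
    linarith
  have hjl : j = l := le_antisymm (not_lt.1 (key hkl hij h.symm)) (not_lt.1 (key hij hkl h))
  subst hjl
  refine ⟨Nat.pow_right_injective le_rfl ?_, rfl⟩
  have : (2 : ℤ) ^ i = 2 ^ k := by linarith
  exact_mod_cast this

/-! ### Generation and the count -/

open Matrix commutatorElement in
/-- A finite nilpotent group with a faithful unitriangular representation of dimension `n` over
`ZMod 2` is generated by at most `n ^ 2 / 4` elements. -/
theorem exists_closure_eq_top_of_unitriangular {n : ℕ} {G : Type*} [Group G] [Finite G]
    [Group.IsNilpotent G] (φ : G →* Matrix (Fin n) (Fin n) (ZMod 2)) (hφ : Function.Injective φ)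
    (hut : ∀ g i j, (φ g - 1) i j ≠ 0 → i < j) :
    ∃ S : Finset G, Subgroup.closure (S : Set G) = ⊤ ∧ 4 * S.card ≤ n ^ 2 := by
  classical
  let a : Fin n → ℤ := fun i => 2 ^ (i : ℕ)
  have ha : StrictMono a := fun i j hij => pow_lt_pow_right₀ (by norm_num) hij
  have hmem_one : ∀ g, φ g - 1 ∈ weightFiltration a 1 := fun g i j h => by
    have := ha (hut g i j h)
    linarith
  have hlead : ∀ g, g ≠ 1 → ∃ i j, (φ g).HasUnipotentLeadingEntry a i j := by
    intro g hg
    have hne : φ g - 1 ≠ 0 := fun h => hg (hφ (by rw [map_one]; exact sub_eq_zero.1 h))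
    obtain ⟨⟨i, j⟩, hij, hmin⟩ := Finset.exists_min_image
      (Finset.univ.filter fun p : Fin n × Fin n => (φ g - 1) p.1 p.2 ≠ 0)
      (fun p => a p.2 - a p.1) (by
        by_contra hempty
        refine hne (Matrix.ext fun i j => ?_)
        by_contra hij
        exact hempty ⟨(i, j), Finset.mem_filter.2 ⟨Finset.mem_univ _, hij⟩⟩)
    simp only [Finset.mem_filter, Finset.mem_univ, true_and] at hij hmin
    have hlt := hut g i j hij
    refine ⟨i, j, hlt, fun k l hkl => ?_⟩
    by_cases hpos : i = k ∧ j = l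
    · obtain ⟨rfl, rfl⟩ := hpos
      refine absurd ?_ hkl
      have hval : ∀ x : ZMod 2, x ≠ 0 → x - 1 = 0 := by decide
      rw [Matrix.sub_apply _ (single i j 1), single_apply_same]
      exact hval _ hij
    · rw [Matrix.sub_apply _ (single i j 1), single_apply_of_ne _ _ _ _ _ hpos, sub_zero] at hkl
      have hle := hmin (k, l) hkl
      have hne' : a j - a i ≠ a l - a k := fun h => hpos <| by
        have := two_pow_sub_two_pow_injective hlt (hut g k l hkl) h
        exact ⟨Fin.ext this.1, Fin.ext this.2⟩
      exact lt_of_le_of_ne hle hne'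
  have hgen : ∀ K : Subgroup G, (∀ g i j, (φ g).HasUnipotentLeadingEntry a i j →
      ∃ h ∈ K, (φ h).HasUnipotentLeadingEntry a i j) → K = ⊤ := by
    intro K hK
    -- Downward induction on the weight: all weights are below 2^n, so `N = 0` forces g = 1;
    -- otherwise multiplying by an element of K with the same leading entry raises the weight.
    have key : ∀ (N : ℕ) (g : G), φ g - 1 ∈ weightFiltration a (2 ^ n - N) → g ∈ K := by
      intro N
      induction N with
      | zero =>
        intro g hg
        by_contra hgK
        obtain ⟨i, j, hij⟩ := hlead g fun h => hgK (h ▸ K.one_mem)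
        have h₁ := hij.le_weight hg
        have h₂ : a j < 2 ^ n := pow_lt_pow_right₀ (by norm_num) j.2
        have h₃ : 0 < a i := by positivity
        push_cast at h₁
        linarith
      | succ N ih =>
        intro g hg
        by_contra hgK
        obtain ⟨i, j, hij⟩ := hlead g fun h => hgK (h ▸ K.one_mem)
        obtain ⟨h, hhK, hh⟩ := hK g i j hij
        have h₁ := hij.le_weight hg
        push_cast at h₁
        refine hgK ((K.mul_mem_cancel_right hhK).1 (ih _ ?_))
        rw [map_mul]
        exact weightFiltration.mono (by linarith) (hij.mul_sub_one_mem ha hh)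
    refine (Subgroup.eq_top_iff' K).2 fun g => key (2 ^ n) g ?_
    exact weightFiltration.mono (by push_cast; linarith) (hmem_one g)
  let E : Finset (Fin n × Fin n) := Finset.univ.filter fun p =>
    (∃ g, (φ g).HasUnipotentLeadingEntry a p.1 p.2) ∧ ¬ ∃ d ∈ commutator G, (φ d).HasUnipotentLeadingEntry a p.1 p.2
  have hE : ∀ i j, (i, j) ∈ E ↔ (∃ g, (φ g).HasUnipotentLeadingEntry a i j) ∧
      ¬ ∃ d ∈ commutator G, (φ d).HasUnipotentLeadingEntry a i j := fun i j => by simp [E]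
  have hcard : 4 * E.card ≤ n ^ 2 := by
    refine four_mul_card_le_sq_of_triangleFree E (fun i j h => ?_) fun i j k hij hjk hik => ?_
    · obtain ⟨⟨g, hg⟩, -⟩ := (hE i j).1 h
      exact hg.1
    · obtain ⟨⟨g, hg⟩, -⟩ := (hE i j).1 hij
      obtain ⟨⟨h, hh⟩, -⟩ := (hE j k).1 hjk
      refine ((hE i k).1 hik).2 ⟨⁅g, h⁆, Subgroup.commutator_mem_commutator
        (Subgroup.mem_top g) (Subgroup.mem_top h), ?_⟩
      refine hg.commutator ha hh (hmem_one (h * g)⁻¹) ?_ ?_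
      · rw [← map_mul, ← map_mul, mul_inv_cancel, map_one]
      · rw [← map_mul, ← map_mul, _root_.mul_inv_rev, commutatorElement_def, mul_assoc (g * h)]
  choose! s hs using fun p : Fin n × Fin n => fun hp : p ∈ E => ((hE p.1 p.2).1 hp).1
  refine ⟨E.image s, ?_, (Nat.mul_le_mul_left 4 Finset.card_image_le).trans hcard⟩
  -- Leading positions in E come from the chosen elements, all others from the commutator subgroup.
  refine eq_top_of_sup_commutator_eq_top _ (hgen _ fun g i j hg => ?_)
  by_cases hij : (i, j) ∈ E
  · refine ⟨s (i, j), ?_, hs _ hij⟩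
    exact Subgroup.mem_sup_left (Subgroup.subset_closure (Finset.mem_image_of_mem s hij))
  · have hd : ∃ d ∈ commutator G, (φ d).HasUnipotentLeadingEntry a i j := by
      by_contra hd
      exact hij ((hE i j).2 ⟨⟨g, hg⟩, hd⟩)
    obtain ⟨d, hdmem, hd⟩ := hd
    exact ⟨d, Subgroup.mem_sup_right hdmem, hd⟩

theorem mainTheorem4 (n : ℕ) (G : Subgroup (Matrix.GeneralLinearGroup (Fin n) (ZMod 2)))
    (hG : IsPGroup 2 G) :
    ∃ S : Finset (Matrix.GeneralLinearGroup (Fin n) (ZMod 2)),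
      Subgroup.closure (S : Set (Matrix.GeneralLinearGroup (Fin n) (ZMod 2))) = G ∧
        (S.card : ℚ) ≤ (n : ℚ) ^ 2 / 4 := by
  classical
  have : Group.IsNilpotent G := hG.isNilpotent
  let ρ : G →* Module.End (ZMod 2) (Fin n → ZMod 2) :=
    ((Matrix.toLinAlgEquiv' : Matrix (Fin n) (Fin n) (ZMod 2) ≃ₐ[ZMod 2] _) : _ →* _).comp
      ((Units.coeHom _).comp G.subtype)
  have hρ : Function.Injective ρ := fun g h hgh =>
    Subtype.ext (Units.ext (Matrix.toLinAlgEquiv'.injective hgh))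
  obtain ⟨b, hb⟩ := hG.exists_unitriangular_basis ρ (n := n) (by simp)
  let φ : G →* Matrix (Fin n) (Fin n) (ZMod 2) :=
    ((LinearMap.toMatrixAlgEquiv b : _ ≃ₐ[ZMod 2] _) : _ →* _).comp ρ
  have hφ : Function.Injective φ := fun g h hgh =>
    hρ ((LinearMap.toMatrixAlgEquiv b).injective hgh)
  have hut : ∀ g i j, (φ g - 1) i j ≠ 0 → i < j := by
    intro g i j h
    have h₁ : (φ g - 1) i j = b.repr (ρ g (b j) - b j) i := by
      have h₂ : φ g - 1 = LinearMap.toMatrixAlgEquiv b (ρ g - 1) := by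
        rw [map_sub, map_one]
        rfl
      rw [h₂, LinearMap.toMatrixAlgEquiv_apply]
      rfl
    rw [h₁] at h
    exact (b.mem_span_image.1 (hb g j)) (Finsupp.mem_support_iff.2 h)
  obtain ⟨S, hS, hcard⟩ := exists_closure_eq_top_of_unitriangular φ hφ hut
  refine ⟨S.map (Function.Embedding.subtype _), ?_, ?_⟩
  · have h := MonoidHom.map_closure G.subtype (S : Set G)
    rw [hS, ← MonoidHom.range_eq_map, Subgroup.range_subtype] at h
    rw [Finset.coe_map]
    exact h.symm
  · rw [Finset.card_map, le_div_iff₀ (by norm_num)]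
    have : (4 * S.card : ℚ) ≤ (n : ℚ) ^ 2 := by exact_mod_cast hcard
    linarith
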